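/- Let $B$ be a real Banach space. For a nonempty set $A\subset B$ write $\operatorname{dist}(x,A)=\inf_{a\in A}\|x-a\|$. For $\alpha\ge 0$, a nonempty closed set $P\subset B$ is called $\alpha$-paraconvex if for every open ball $D\subset B$ of radius $r>0$ and every $q\in\operatorname{conv}(P\cap D)$ one has $\operatorname{dist}(q,P)\le\alpha r$. Let $\mathrm{bexp}_\alpha(B)$ be the family of all bounded $\alpha$-paraconvex subsets of $B$, endowed with the Hausdorff metric, and let $C_b(B,B)$ be the Banach space of all bounded continuous mappings of $B$ into itself with the supremum norm. For a nonempty bounded set $A\subset B$ let $URetr(A)\subset C_b(B,B)$ be the set of all continuous retractions $R$ of $B$ onto $A$ (that is, $R(x)\in A$ for all $x\in B$ and $R(x)=x$ for all $x\in A$) which are uniform with respect to $A$: for every $\varepsilon>0$ there is $\delta>0$ such that for all $x\in B$, $\operatorname{dist}(x,A)<\delta$ implies $\|x-R(x)\|<\varepsilon$. **Proposition 2.4.** For every $0\le\alpha<\frac12$ the multivalued mapping $P\mapsto URetr(P)$ on $\mathrm{bexp}_\alpha(B)$ admits a continuous single-valued selection, i.e. there is a continuous mapping $\mathfrak R:\mathrm{bexp}_\alpha(B)\to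 C_b(B,B)$, $P\mapsto\mathfrak R_P$, with $\mathfrak R_P\in URetr(P)$ for every $P\in\mathrm{bexp}_\alpha(B)$. -/

import Mathlib

open Set Metric Bornology
open scoped BoundedContinuousFunction

/-- A nonempty closed subset `P` of a normed space is `α`-paraconvex if for every open ball
`D` of radius `r > 0` every point `q` of `conv (P ∩ D)` satisfies `dist (q, P) ≤ α * r`. -/
structure IsParaconvex {B : Type*} [NormedAddCommGroup B] [NormedSpace ℝ B]
    (α : ℝ) (P : Set B) : Prop where
  nonempty : P.Nonempty
  isClosed : IsClosed P
  infDist_le : ∀ (c : B) (r : ℝ), 0 < r →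
    ∀ q ∈ convexHull ℝ (P ∩ ball c r), infDist q P ≤ α * r

/-- The family of all bounded `α`-paraconvex subsets of `B`. -/
@[ext]
structure BExp (α : ℝ) (B : Type*) [NormedAddCommGroup B] [NormedSpace ℝ B] where
  carrier : Set B
  isBounded : IsBounded carrier
  isParaconvex : IsParaconvex α carrier

theorem BExp.hausdorffEDist_ne_top {α : ℝ} {B : Type*} [NormedAddCommGroup B] [NormedSpace ℝ B]
    (P Q : BExp α B) : hausdorffEDist P.carrier Q.carrier ≠ ⊤ :=
  hausdorffEDist_ne_top_of_nonempty_of_bounded P.isParaconvex.nonempty Q.isParaconvex.nonempty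
    P.isBounded Q.isBounded

/-- The family of bounded `α`-paraconvex subsets is endowed with the Hausdorff metric. -/
noncomputable instance BExp.instMetricSpace {α : ℝ} {B : Type*} [NormedAddCommGroup B]
    [NormedSpace ℝ B] : MetricSpace (BExp α B) where
  dist P Q := hausdorffDist P.carrier Q.carrier
  dist_self _ := hausdorffDist_self_zero
  dist_comm _ _ := hausdorffDist_comm
  dist_triangle P Q _ := hausdorffDist_triangle (P.hausdorffEDist_ne_top Q)
  eq_of_dist_eq_zero {P Q} h := BExp.ext
    ((P.isParaconvex.isClosed.hausdorffDist_zero_iff_eq Q.isParaconvex.isClosed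
      (P.hausdorffEDist_ne_top Q)).1 h)

/-- `R : B → B` is a continuous retraction of `B` onto `A` which is uniform with respect
to `A`. (This is not uniform continuity of `R`.) -/
structure IsUniformRetraction {B : Type*} [NormedAddCommGroup B] (A : Set B) (R : B → B) :
    Prop where
  continuous : Continuous R
  mem : ∀ x, R x ∈ A
  eq_self : ∀ x ∈ A, R x = x
  uniform : ∀ ε > 0, ∃ δ > 0, ∀ x, infDist x A < δ → dist x (R x) < ε

/-- The set of all uniform retractions of `B` onto `A`, as a subset of the space of bounded
continuous mappings of `B` into itself with the supremum norm (if `A` is bounded, every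
retraction onto `A` is bounded). -/
def URetr {B : Type*} [NormedAddCommGroup B] (A : Set B) : Set (B →ᵇ B) :=
  {R | IsUniformRetraction A R}

/-!
Retractions of `B` onto an `α`-paraconvex set `P` come from Michael's selection theorem for
paraconvex values, applied to the constant mapping `P` on the complement of `P` with an error
proportional to the distance to `P`: they move no point `x` by more than `dist (x, P) / (1 - β)`,
where `β > α` is arbitrary. Composing a mapping `Q` of `B` with such a retraction corrects `Q` into
one with values in `P` at a cost proportional to its distance from `P`. A convex combination of
uniform retractions onto `P` from a ball of radius `r` has values within `α * r` of `P`, so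
`URetr P` is `α / (1 - α)`-paraconvex, and `α / (1 - α) < 1` when `α < 1 / 2`. If `P'` is close to
`P`, a uniform retraction onto `P` moves points near `P'` only a little; interpolating it there with
the identity and then correcting it yields a nearby uniform retraction onto `P'`. Hence
`P ↦ URetr P` is lower hemicontinuous, and a second application of Michael's theorem, now on the
metric space of all `P`, gives the selection.
-/

open Filter Topology

/-! ### Selections of paraconvex-valued mappings -/

theorem IsParaconvex.nonneg {E : Type*} [NormedAddCommGroup E] [NormedSpace ℝ E] {α : ℝ}
    {P : Set E} (hP : IsParaconvex α P) : 0 ≤ α := by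
  obtain ⟨x, hx⟩ := hP.nonempty
  have hle : infDist x P ≤ α * 1 :=
    hP.infDist_le x 1 one_pos x (subset_convexHull ℝ _ ⟨hx, mem_ball_self one_pos⟩)
  exact infDist_nonneg.trans (hle.trans_eq (mul_one α))

theorem exists_continuous_tendsto_of_dist_le_geometric {X E : Type*} [TopologicalSpace X]
    [PseudoMetricSpace E] [CompleteSpace E] {u : ℕ → X → E} {r : X → ℝ} {β : ℝ} (hβ₀ : 0 ≤ β)
    (hβ₁ : β < 1) (hu : ∀ n, Continuous (u n)) (hr : Continuous r)
    (hdist : ∀ n x, dist (u n x) (u (n + 1) x) ≤ r x * β ^ n) :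
    ∃ g : X → E, Continuous g ∧ ∀ x, Tendsto (fun n ↦ u n x) atTop (𝓝 (g x)) := by
  have hcauchy (x : X) : CauchySeq fun n ↦ u n x :=
    cauchySeq_of_le_geometric β (r x) hβ₁ fun n ↦ hdist n x
  choose g hg using fun x ↦ cauchySeq_tendsto_of_complete (hcauchy x)
  have herror (n : ℕ) (x : X) : dist (u n x) (g x) ≤ r x * β ^ n / (1 - β) :=
    dist_le_of_le_geometric_of_tendsto β (r x) hβ₁ (fun n ↦ hdist n x) (hg x) n
  have hunif : TendstoLocallyUniformly u g atTop := by
    refine Metric.tendstoLocallyUniformly_iff.2 fun ε hε x ↦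
      ⟨{y | r y < r x + 1}, hr.continuousAt.eventually_lt_const (lt_add_one _), ?_⟩
    have hzero : Tendsto (fun n : ℕ ↦ (r x + 1) * β ^ n / (1 - β)) atTop (𝓝 0) := by
      simpa using ((tendsto_pow_atTop_nhds_zero_of_lt_one hβ₀ hβ₁).const_mul (r x + 1)).div_const
        (1 - β)
    filter_upwards [hzero.eventually_lt_const hε] with n hn y (hy : r y < r x + 1)
    have : 0 < 1 - β := sub_pos.2 hβ₁
    calc dist (g y) (u n y) ≤ r y * β ^ n / (1 - β) := dist_comm (g y) _ ▸ herror n y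
      _ ≤ (r x + 1) * β ^ n / (1 - β) := by gcongr
      _ < ε := hn
  exact ⟨g, hunif.continuous (Frequently.of_forall hu), hg⟩

section Selection

variable {X E : Type*} [TopologicalSpace X] [NormalSpace X] [ParacompactSpace X]

theorem exists_continuous_infDist_lt [PseudoMetricSpace E] {F : X → Set E}
    (hlsc : LowerHemicontinuous F) (hF : ∀ x, (F x).Nonempty) (y : E) :
    ∃ ρ : X → ℝ, Continuous ρ ∧ ∀ x, infDist y (F x) < ρ x := by
  have hloc (x : X) : ∃ c : ℝ, ∀ᶠ x' in 𝓝 x, c ∈ Ioi (infDist y (F x')) := by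
    obtain ⟨z, hz⟩ := hF x
    refine ⟨dist y z + 1, ?_⟩
    filter_upwards [hlsc x (ball z 1) ⟨isOpen_ball, z, hz, mem_ball_self one_pos⟩]
      with x' ⟨_, z', hz', hzz'⟩
    calc infDist y (F x') ≤ dist y z' := infDist_le_dist_of_mem hz'
      _ ≤ dist y z + dist z z' := dist_triangle ..
      _ < dist y z + 1 := by gcongr; exact mem_ball'.1 hzz'
  obtain ⟨ρ, hρ⟩ := exists_continuous_forall_mem_convex_of_local_const
    (fun x ↦ convex_Ioi (infDist y (F x))) hloc
  exact ⟨ρ, ρ.continuous, hρ⟩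

variable [NormedAddCommGroup E] [NormedSpace ℝ E] {F : X → Set E} {f : X → E} {r : X → ℝ}
  {α β : ℝ}

theorem exists_continuous_infDist_lt_mul (hlsc : LowerHemicontinuous F)
    (hF : ∀ x, IsParaconvex α (F x)) (hαβ : α < β) (hf : Continuous f) (hr : Continuous r)
    (hfr : ∀ x, infDist (f x) (F x) < r x) :
    ∃ g : X → E, Continuous g ∧ ∀ x, dist (f x) (g x) < r x ∧ infDist (g x) (F x) < β * r x := by
  have hr₀ (x : X) : 0 < r x := infDist_nonneg.trans_lt (hfr x)
  let t (x : X) : Set E := ball (f x) (r x) ∩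
    thickening ((β - α) * r x) (convexHull ℝ (F x ∩ ball (f x) (r x)))
  have ht (x : X) : Convex ℝ (t x) :=
    (convex_ball _ _).inter ((convex_convexHull ℝ _).thickening _)
  have hloc (x : X) : ∃ c : E, ∀ᶠ y in 𝓝 x, c ∈ t y := by
    obtain ⟨c, hcF, hc⟩ := (infDist_lt_iff (hF x).nonempty).1 (hfr x)
    obtain ⟨ε, hε, hε'⟩ :=
      exists_between (lt_min (mul_pos (sub_pos.2 hαβ) (hr₀ x)) (sub_pos.2 hc))
    obtain ⟨hε₁, hε₂⟩ := lt_min_iff.1 hε'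
    have hthick : ∀ᶠ y in 𝓝 x, ε < (β - α) * r y :=
      (continuous_const.mul hr).continuousAt.eventually_const_lt hε₁
    have hball : ∀ᶠ y in 𝓝 x, ε < r y - dist (f y) c :=
      (hr.sub (hf.dist continuous_const)).continuousAt.eventually_const_lt hε₂
    refine ⟨c, ?_⟩
    filter_upwards [hthick, hball, hlsc x (ball c ε) ⟨isOpen_ball, c, hcF, mem_ball_self hε⟩]
      with y hy₁ hy₂ ⟨_, z, hzF, hz⟩
    have hcz : dist c z < ε := mem_ball'.1 hz
    have hzy : z ∈ ball (f y) (r y) := mem_ball'.2 (by linarith [dist_triangle (f y) c z])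
    exact ⟨mem_ball'.2 (by linarith),
      mem_thickening_iff.2 ⟨z, subset_convexHull ℝ _ ⟨hzF, hzy⟩, hcz.trans hy₁⟩⟩
  obtain ⟨g, hg⟩ := exists_continuous_forall_mem_convex_of_local_const ht hloc
  refine ⟨g, g.continuous, fun x ↦ ⟨mem_ball'.1 (hg x).1, ?_⟩⟩
  obtain ⟨q, hq, hgq⟩ := mem_thickening_iff.1 (hg x).2
  calc infDist (g x) (F x) ≤ infDist q (F x) + dist (g x) q := infDist_le_infDist_add_dist
    _ < α * r x + (β - α) * r x :=
      add_lt_add_of_le_of_lt ((hF x).infDist_le (f x) (r x) (hr₀ x) q hq) hgq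
    _ = β * r x := by ring

theorem exists_seq_continuous_infDist_lt_geometric (hlsc : LowerHemicontinuous F)
    (hF : ∀ x, IsParaconvex α (F x)) (hαβ : α < β) (hf : Continuous f) (hr : Continuous r)
    (hfr : ∀ x, infDist (f x) (F x) < r x) :
    ∃ u : ℕ → X → E, u 0 = f ∧ ∀ n, Continuous (u n) ∧ ∀ x,
      infDist (u n x) (F x) < r x * β ^ n ∧ dist (u n x) (u (n + 1) x) ≤ r x * β ^ n := by
  let Approx (n : ℕ) := {v : X → E // Continuous v ∧ ∀ x, infDist (v x) (F x) < r x * β ^ n}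
  have hstep (n : ℕ) (v : Approx n) :
      ∃ w : Approx (n + 1), ∀ x, dist (v.1 x) (w.1 x) ≤ r x * β ^ n := by
    obtain ⟨g, hg, hgx⟩ := exists_continuous_infDist_lt_mul (r := fun x ↦ r x * β ^ n) hlsc hF hαβ
      v.2.1 (hr.mul continuous_const) v.2.2
    exact ⟨⟨g, hg, fun x ↦ (hgx x).2.trans_eq (by ring)⟩, fun x ↦ (hgx x).1.le⟩
  choose improve himprove using hstep
  let u (n : ℕ) : Approx n := Nat.rec ⟨f, hf, by simpa using hfr⟩ improve n
  exact ⟨fun n ↦ (u n).1, rfl, fun n ↦ ⟨(u n).2.1, fun x ↦ ⟨(u n).2.2 x, himprove n (u n) x⟩⟩⟩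

variable [CompleteSpace E]

theorem exists_continuous_selection_dist_le (hlsc : LowerHemicontinuous F)
    (hF : ∀ x, IsParaconvex α (F x)) (hαβ : α < β) (hβ : β < 1) (hf : Continuous f)
    (hr : Continuous r) (hfr : ∀ x, infDist (f x) (F x) < r x) :
    ∃ g : X → E, Continuous g ∧ ∀ x, g x ∈ F x ∧ dist (f x) (g x) ≤ r x / (1 - β) := by
  rcases isEmpty_or_nonempty X with _ | ⟨⟨x₀⟩⟩
  · exact ⟨f, hf, isEmptyElim⟩
  have hβ₀ : 0 ≤ β := (hF x₀).nonneg.trans hαβ.le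
  obtain ⟨u, rfl, hu⟩ := exists_seq_continuous_infDist_lt_geometric hlsc hF hαβ hf hr hfr
  obtain ⟨g, hg, hlim⟩ := exists_continuous_tendsto_of_dist_le_geometric hβ₀ hβ
    (fun n ↦ (hu n).1) hr fun n x ↦ ((hu n).2 x).2
  refine ⟨g, hg, fun x ↦ ⟨((hF x).isClosed.mem_iff_infDist_zero (hF x).nonempty).2 ?_,
    dist_le_of_le_geometric_of_tendsto₀ β (r x) hβ (fun n ↦ ((hu n).2 x).2) (hlim x)⟩⟩
  have hinfDist : Tendsto (fun n ↦ infDist (u n x) (F x)) atTop (𝓝 (infDist (g x) (F x))) :=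
    ((continuous_infDist_pt (F x)).tendsto _).comp (hlim x)
  have hzero : Tendsto (fun n : ℕ ↦ r x * β ^ n) atTop (𝓝 0) := by
    simpa using (tendsto_pow_atTop_nhds_zero_of_lt_one hβ₀ hβ).const_mul (r x)
  exact (le_of_tendsto_of_tendsto' hinfDist hzero fun n ↦ ((hu n).2 x).1.le).antisymm
    infDist_nonneg

theorem exists_continuous_selection (hlsc : LowerHemicontinuous F)
    (hF : ∀ x, IsParaconvex α (F x)) (hα : α < 1) :
    ∃ g : X → E, Continuous g ∧ ∀ x, g x ∈ F x := by
  obtain ⟨β, hαβ, hβ⟩ := exists_between hα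
  obtain ⟨ρ, hρ, hρF⟩ := exists_continuous_infDist_lt hlsc (fun x ↦ (hF x).nonempty) 0
  obtain ⟨g, hg, hgF⟩ := exists_continuous_selection_dist_le hlsc hF hαβ hβ continuous_const hρ hρF
  exact ⟨g, hg, fun x ↦ (hgF x).1⟩

end Selection

/-! ### Retractions onto a paraconvex set -/

section PseudoMetricSpace

variable {X : Type*} [PseudoMetricSpace X]

theorem continuous_of_dist_le_mul_infDist {P : Set X} (hP : IsClosed P) {R : X → X}
    (hR : ContinuousOn R Pᶜ) {C : ℝ} (hdist : ∀ x, dist x (R x) ≤ C * infDist x P) :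
    Continuous R := by
  refine continuous_iff_continuousAt.2 fun x ↦ ?_
  by_cases hx : x ∈ P
  · have hRx : dist x (R x) ≤ 0 := (hdist x).trans_eq (by rw [infDist_zero_of_mem hx, mul_zero])
    have hbound : Continuous fun y ↦ C * infDist y P + dist y x :=
      (continuous_const.mul (continuous_infDist_pt P)).add (continuous_id.dist continuous_const)
    refine tendsto_iff_dist_tendsto_zero.2 (squeeze_zero (fun _ ↦ dist_nonneg) (fun y ↦ ?_)
      (by simpa [infDist_zero_of_mem hx] using hbound.tendsto x))
    calc dist (R y) (R x) ≤ dist (R y) y + dist y x + dist x (R x) := dist_triangle4 ..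
      _ ≤ C * infDist y P + dist y x := by linarith [hdist y, dist_comm y (R y)]
  · exact hR.continuousAt (hP.isOpen_compl.mem_nhds hx)

/-- The distance from `x` to `Q x` tends to zero uniformly as `x` approaches `A`. For a continuous
retraction `Q` onto `A`, this is the uniformity with respect to `A` required in
`IsUniformRetraction`; it is also meaningful for mappings with values outside `A`. -/
def IsUniformlyIdNear (A : Set X) (Q : X → X) : Prop :=
  ∀ ε > 0, ∃ δ > 0, ∀ x, infDist x A < δ → dist x (Q x) < ε

theorem isUniformlyIdNear_id (A : Set X) : IsUniformlyIdNear A id :=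
  fun _ hε ↦ ⟨1, one_pos, fun _ _ ↦ by simpa using hε⟩

theorem IsUniformlyIdNear.eq_self {X : Type*} [MetricSpace X] {A : Set X} {Q : X → X}
    (hQ : IsUniformlyIdNear A Q) {x : X} (hx : x ∈ A) : Q x = x := by
  refine (eq_of_forall_dist_le fun ε hε ↦ ?_).symm
  obtain ⟨δ, hδ, h⟩ := hQ ε hε
  exact (h x (by rwa [infDist_zero_of_mem hx])).le

theorem IsUniformlyIdNear.comp_left {A : Set X} {Q S : X → X} (hQ : IsUniformlyIdNear A Q) {C : ℝ}
    (hC : 0 ≤ C) (hS : ∀ x, dist x (S x) ≤ C * infDist x A) : IsUniformlyIdNear A (S ∘ Q) := by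
  intro ε hε
  set η := ε / (1 + 2 * C) with hη
  have hη₀ : 0 < η := by positivity
  obtain ⟨δ, hδ, h⟩ := hQ η hη₀
  refine ⟨min δ η, lt_min hδ hη₀, fun x hx ↦ ?_⟩
  obtain ⟨hxδ, hxη⟩ := lt_min_iff.1 hx
  have hxQ : dist x (Q x) < η := h x hxδ
  have hQA : infDist (Q x) A ≤ η + η :=
    infDist_le_infDist_add_dist.trans (add_le_add hxη.le (dist_comm x (Q x) ▸ hxQ.le))
  calc dist x (S (Q x)) ≤ dist x (Q x) + dist (Q x) (S (Q x)) := dist_triangle ..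
    _ ≤ dist x (Q x) + C * infDist (Q x) A := by gcongr; exact hS (Q x)
    _ < η + C * (η + η) := add_lt_add_of_lt_of_le hxQ (by gcongr)
    _ = ε := by rw [hη]; field_simp; ring

theorem isClosed_setOf_isUniformlyIdNear (A : Set X) :
    IsClosed {Q : X →ᵇ X | IsUniformlyIdNear A Q} := by
  refine isClosed_of_closure_subset fun Q hQ ε hε ↦ ?_
  obtain ⟨S, hS, hQS⟩ := Metric.mem_closure_iff.1 hQ (ε / 2) (half_pos hε)
  obtain ⟨δ, hδ, h⟩ := hS (ε / 2) (half_pos hε)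
  refine ⟨δ, hδ, fun x hx ↦ ?_⟩
  calc dist x (Q x) ≤ dist x (S x) + dist (Q x) (S x) := dist_triangle_right ..
    _ < ε / 2 + ε / 2 :=
      add_lt_add (h x hx) ((BoundedContinuousFunction.dist_coe_le_dist x).trans_lt hQS)
    _ = ε := add_halves ε

end PseudoMetricSpace

section Retraction

variable {B : Type*} [NormedAddCommGroup B]

theorem mem_uRetr_iff {A : Set B} {R : B →ᵇ B} :
    R ∈ URetr A ↔ (∀ x, R x ∈ A) ∧ IsUniformlyIdNear A R :=
  ⟨fun h ↦ ⟨h.mem, h.uniform⟩, fun h ↦ ⟨R.continuous, h.1, fun _ ↦ h.2.eq_self, h.2⟩⟩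

theorem isClosed_uRetr {A : Set B} (hA : IsClosed A) : IsClosed (URetr A) := by
  have hmem : IsClosed {R : B →ᵇ B | ∀ x, R x ∈ A} := by
    simp only [ofPred_forall]
    exact isClosed_iInter fun x ↦
      hA.preimage (continuous_eval_const x)
  convert hmem.inter (isClosed_setOf_isUniformlyIdNear A) using 1
  ext R
  exact mem_uRetr_iff

variable [NormedSpace ℝ B]

theorem convex_setOf_isUniformlyIdNear (A : Set B) :
    Convex ℝ {Q : B →ᵇ B | IsUniformlyIdNear A Q} := by
  intro Q hQ R hR a b ha hb hab ε hε
  obtain ⟨δ, hδ, hQδ⟩ := hQ ε hε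
  obtain ⟨δ', hδ', hRδ'⟩ := hR ε hε
  refine ⟨min δ δ', lt_min hδ hδ', fun x hx ↦ ?_⟩
  obtain ⟨hxδ, hxδ'⟩ := lt_min_iff.1 hx
  exact mem_ball'.1 (convex_ball x ε (mem_ball'.2 (hQδ x hxδ)) (mem_ball'.2 (hRδ' x hxδ'))
    ha hb hab)

theorem isUniformlyIdNear_of_mem_convexHull_uRetr {A : Set B} {s : Set (B →ᵇ B)} {Q : B →ᵇ B}
    (hQ : Q ∈ convexHull ℝ (URetr A ∩ s)) : IsUniformlyIdNear A Q :=
  convexHull_min (fun _ hR ↦ (mem_uRetr_iff.1 hR.1).2) (convex_setOf_isUniformlyIdNear A) hQ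

theorem apply_mem_convexHull_of_mem_convexHull_uRetr {A : Set B} {h Q : B →ᵇ B} {r : ℝ}
    (hQ : Q ∈ convexHull ℝ (URetr A ∩ ball h r)) (x : B) :
    Q x ∈ convexHull ℝ (A ∩ ball (h x) r) := by
  have hsub : URetr A ∩ ball h r ⊆
      BoundedContinuousFunction.evalCLM ℝ x ⁻¹' convexHull ℝ (A ∩ ball (h x) r) :=
    fun R hR ↦ subset_convexHull ℝ _ ⟨hR.1.mem x,
      (BoundedContinuousFunction.dist_coe_le_dist x).trans_lt hR.2⟩
  exact convexHull_min hsub ((convex_convexHull ℝ _).is_linear_preimage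
    (BoundedContinuousFunction.evalCLM ℝ x).isLinear) hQ

theorem exists_isUniformlyIdNear_dist_le {A : Set B} {R : B → B} (hR : Continuous R) {δ η : ℝ}
    (hδ : 0 < δ) (hη : 0 < η) (hRη : ∀ x, infDist x A < δ → dist x (R x) ≤ η) :
    ∃ Q : B → B, Continuous Q ∧ IsUniformlyIdNear A Q ∧ ∀ x, dist (Q x) (R x) ≤ η := by
  let φ (x : B) : ℝ := min 1 (infDist x A / δ)
  have hφ₀ (x : B) : 0 ≤ φ x := le_min zero_le_one (div_nonneg infDist_nonneg hδ.le)
  have hφ₁ (x : B) : φ x ≤ 1 := min_le_left _ _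
  have hφ : Continuous φ := continuous_const.min ((continuous_infDist_pt A).div_const δ)
  refine ⟨fun x ↦ AffineMap.lineMap x (R x) (φ x), continuous_id.lineMap hR hφ,
    fun ε hε ↦ ⟨min δ (ε / η * δ), by positivity, fun x hx ↦ ?_⟩, fun x ↦ ?_⟩
  · obtain ⟨hxδ, hxε⟩ := lt_min_iff.1 hx
    rw [dist_left_lineMap, Real.norm_of_nonneg (hφ₀ x)]
    calc φ x * dist x (R x) ≤ infDist x A / δ * η := by
          gcongr
          exacts [div_nonneg infDist_nonneg hδ.le, min_le_right _ _, hRη x hxδ]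
      _ < ε / η * η := mul_lt_mul_of_pos_right ((div_lt_iff₀ hδ).2 hxε) hη
      _ = ε := div_mul_cancel₀ ε hη.ne'
  · rw [dist_lineMap_right, Real.norm_of_nonneg (sub_nonneg.2 (hφ₁ x))]
    rcases lt_or_ge (infDist x A) δ with hx | hx
    · exact (mul_le_of_le_one_left dist_nonneg (sub_le_self 1 (hφ₀ x))).trans (hRη x hx)
    · have hφx : φ x = 1 := min_eq_left ((one_le_div hδ).2 hx)
      rw [hφx, sub_self, zero_mul]
      exact hη.le

variable [CompleteSpace B] {α β : ℝ} {P : Set B}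

theorem IsParaconvex.exists_retraction_dist_le (hP : IsParaconvex α P) (hαβ : α < β)
    (hβ : β < 1) :
    ∃ R : B → B, Continuous R ∧ ∀ x, R x ∈ P ∧ dist x (R x) ≤ (1 - β)⁻¹ * infDist x P := by
  classical
  obtain ⟨γ, hαγ, hγβ⟩ := exists_between hαβ
  have hβ' : 0 < 1 - β := sub_pos.2 hβ
  have hγ' : 1 - γ ≠ 0 := (sub_pos.2 (hγβ.trans hβ)).ne'
  have hpos (x : ↥Pᶜ) : 0 < infDist (x : B) P :=
    (hP.isClosed.notMem_iff_infDist_pos hP.nonempty).1 x.2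
  obtain ⟨g, hg, hgP⟩ := exists_continuous_selection_dist_le (X := ↥Pᶜ) (F := fun _ ↦ P)
    (f := (↑)) (r := fun x ↦ (1 - γ) / (1 - β) * infDist (x : B) P)
    (fun _ _ ht ↦ Eventually.of_forall fun _ ↦ ht) (fun _ ↦ hP) hαγ (hγβ.trans hβ)
    continuous_subtype_val
    (continuous_const.mul ((continuous_infDist_pt P).comp continuous_subtype_val))
    (fun x ↦ lt_mul_of_one_lt_left (hpos x) ((one_lt_div hβ').2 (by linarith)))
  let R (x : B) : B := if hx : x ∈ P then x else g ⟨x, hx⟩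
  have hR (x : B) : R x ∈ P ∧ dist x (R x) ≤ (1 - β)⁻¹ * infDist x P := by
    by_cases hx : x ∈ P
    · simp [R, hx, infDist_zero_of_mem hx]
    · simp only [R, hx, dite_false]
      exact ⟨(hgP ⟨x, hx⟩).1, (hgP ⟨x, hx⟩).2.trans_eq (by field_simp)⟩
  have hRc : ContinuousOn R Pᶜ :=
    continuousOn_iff_continuous_domRestrict.2 (by simpa [R, domRestrict_dite_compl] using hg)
  exact ⟨R, continuous_of_dist_le_mul_infDist hP.isClosed hRc fun x ↦ (hR x).2, hR⟩

theorem IsParaconvex.exists_mem_uRetr_dist_le (hP : IsParaconvex α P) (hb : IsBounded P)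
    (hαβ : α < β) (hβ : β < 1) {Q : B → B} (hQ : Continuous Q) (hQP : IsUniformlyIdNear P Q) :
    ∃ R ∈ URetr P, ∀ x, dist (Q x) (R x) ≤ (1 - β)⁻¹ * infDist (Q x) P := by
  obtain ⟨S, hS, hSP⟩ := hP.exists_retraction_dist_le hαβ hβ
  obtain ⟨C, hC⟩ := isBounded_iff.1 hb
  let R : B →ᵇ B := BoundedContinuousFunction.mkOfBound ⟨S ∘ Q, hS.comp hQ⟩ C
    fun x y ↦ hC (hSP (Q x)).1 (hSP (Q y)).1
  have hR : IsUniformlyIdNear P R :=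
    hQP.comp_left (inv_nonneg.2 (sub_nonneg.2 hβ.le)) fun x ↦ (hSP x).2
  exact ⟨R, mem_uRetr_iff.2 ⟨fun x ↦ (hSP (Q x)).1, hR⟩, fun x ↦ (hSP (Q x)).2⟩

theorem IsParaconvex.uRetr (hP : IsParaconvex α P) (hb : IsBounded P) (hα : α < 1) :
    IsParaconvex (α / (1 - α)) (URetr P) where
  nonempty := by
    obtain ⟨β, hαβ, hβ⟩ := exists_between hα
    obtain ⟨R, hR, -⟩ :=
      hP.exists_mem_uRetr_dist_le hb hαβ hβ continuous_id (isUniformlyIdNear_id P)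
    exact ⟨R, hR⟩
  isClosed := isClosed_uRetr hP.isClosed
  infDist_le h r hr Q hQ := by
    have hbound {β : ℝ} (hαβ : α < β) (hβ : β < 1) :
        infDist Q (URetr P) ≤ (1 - β)⁻¹ * (α * r) := by
      obtain ⟨R, hR, hQR⟩ := hP.exists_mem_uRetr_dist_le hb hαβ hβ Q.continuous
        (isUniformlyIdNear_of_mem_convexHull_uRetr hQ)
      have := hP.nonneg
      have : 0 < 1 - β := sub_pos.2 hβ
      refine (infDist_le_dist_of_mem hR).trans
        ((BoundedContinuousFunction.dist_le (by positivity)).2 fun x ↦ (hQR x).trans ?_)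
      gcongr
      exact hP.infDist_le (h x) r hr (Q x) (apply_mem_convexHull_of_mem_convexHull_uRetr hQ x)
    have hlim : Tendsto (fun β ↦ (1 - β)⁻¹ * (α * r)) (𝓝[>] α) (𝓝 ((1 - α)⁻¹ * (α * r))) :=
      (((tendsto_const_nhds.sub tendsto_id).inv₀ (sub_pos.2 hα).ne').mul_const _).mono_left
        nhdsWithin_le_nhds
    calc infDist Q (URetr P) ≤ (1 - α)⁻¹ * (α * r) :=
          ge_of_tendsto hlim (by
            filter_upwards [Ioo_mem_nhdsGT hα] with β hβ using hbound hβ.1 hβ.2)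
      _ = α / (1 - α) * r := by ring

theorem IsParaconvex.exists_mem_uRetr_dist_le_of_near (hP : IsParaconvex α P) (hb : IsBounded P)
    (hαβ : α < β) (hβ : β < 1) {R : B →ᵇ B} {δ η d : ℝ} (hδ : 0 < δ) (hη : 0 < η)
    (hRη : ∀ x, infDist x P < δ → dist x (R x) ≤ η) (hRP : ∀ x, infDist (R x) P ≤ d) :
    ∃ S ∈ URetr P, dist R S ≤ η + (1 - β)⁻¹ * (d + η) := by
  obtain ⟨Q, hQ, hQP, hQR⟩ := exists_isUniformlyIdNear_dist_le R.continuous hδ hη hRη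
  obtain ⟨S, hS, hQS⟩ := hP.exists_mem_uRetr_dist_le hb hαβ hβ hQ hQP
  have : 0 < 1 - β := sub_pos.2 hβ
  have hQd (x : B) : infDist (Q x) P ≤ d + η :=
    infDist_le_infDist_add_dist.trans (add_le_add (hRP x) (hQR x))
  have hRS (x : B) : dist (R x) (S x) ≤ η + (1 - β)⁻¹ * (d + η) :=
    calc dist (R x) (S x) ≤ dist (Q x) (R x) + dist (Q x) (S x) := dist_triangle_left ..
      _ ≤ η + (1 - β)⁻¹ * infDist (Q x) P := add_le_add (hQR x) (hQS x)
      _ ≤ η + (1 - β)⁻¹ * (d + η) := by gcongr; exact hQd x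
  exact ⟨S, hS, (BoundedContinuousFunction.dist_le_iff_of_nonempty).2 hRS⟩

theorem lowerHemicontinuous_uRetr (hα : α < 1) :
    LowerHemicontinuous fun P : BExp α B ↦ URetr P.carrier := by
  rintro P u ⟨hu, R, hR, hRu⟩
  obtain ⟨ε, hε, hball⟩ := Metric.isOpen_iff.1 hu R hRu
  obtain ⟨β, hαβ, hβ⟩ := exists_between hα
  have : 0 < 1 - β := sub_pos.2 hβ
  obtain ⟨η, hη, hηε⟩ : ∃ η > 0, η + (1 - β)⁻¹ * (η + η) < ε :=
    ⟨ε / (2 * (1 + (1 - β)⁻¹ * 2)), by positivity, by field_simp; linarith⟩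
  obtain ⟨δ, hδ, hRδ⟩ := hR.uniform η hη
  filter_upwards [ball_mem_nhds P (lt_min hη (half_pos hδ))] with P' hP'
  obtain ⟨hPη, hPδ⟩ : hausdorffDist P'.carrier P.carrier < η ∧
      hausdorffDist P'.carrier P.carrier < δ / 2 := lt_min_iff.1 hP'
  have hRη (x : B) (hx : infDist x P'.carrier < δ / 2) : dist x (R x) ≤ η := by
    refine (hRδ x ?_).le
    linarith [infDist_le_infDist_add_hausdorffDist (x := x) (P'.hausdorffEDist_ne_top P)]
  have hRP (x : B) : infDist (R x) P'.carrier ≤ η :=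
    (infDist_le_hausdorffDist_of_mem (hR.mem x) (P.hausdorffEDist_ne_top P')).trans
      (hausdorffDist_comm.trans_le hPη.le)
  obtain ⟨S, hS, hRS⟩ := P'.isParaconvex.exists_mem_uRetr_dist_le_of_near P'.isBounded hαβ hβ
    (half_pos hδ) hη hRη hRP
  exact ⟨hu, S, hS, hball (mem_ball'.2 (hRS.trans_lt hηε))⟩

end Retraction

theorem proposition2p4 {B : Type*} [NormedAddCommGroup B] [NormedSpace ℝ B] [CompleteSpace B]
    (α : ℝ) (hα₀ : 0 ≤ α) (hα : α < 1 / 2) :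
    ∃ R : BExp α B → (B →ᵇ B),
      Continuous R ∧ ∀ P : BExp α B, R P ∈ URetr P.carrier := by
  have hα₁ : α < 1 := by linarith
  have hdiv : α / (1 - α) < 1 := (div_lt_one (sub_pos.2 hα₁)).2 (by linarith)
  exact exists_continuous_selection (lowerHemicontinuous_uRetr hα₁)
    (fun P ↦ P.isParaconvex.uRetr P.isBounded hα₁) hdiv
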